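/- Let $\mathcal{H}$ be a hypergraph on a finite vertex set $V$, with (pairwise distinct) edges $E_1,\dots,E_n$. Let $k$ be a field and let $R=k[x_v : v\in V]$. Let $I(\mathcal{H})\subseteq R$ be the edge ideal, that is, the Stanley--Reisner ideal generated by the monomials $x^F=\prod_{v\in F}x_v$ for all $F\subseteq V$ that contain some edge. A vertex is called free if it lies in at most one edge. Suppose that every edge of $\mathcal{H}$ contains a free vertex. Then: (1) The Taylor complex of the monomials $x^{E_1},\dots,x^{E_n}$ is a graded free resolution of $R/I(\mathcal{H})$, and it is minimal. In this complex, homological degree $i$ has the basis $e_S$, for $S\subseteq\{1,\dots,n\}$ with $|S|=i$. The element $e_S$ has degree $\deg\operatorname{lcm}(x^{E_t}:t\in S)$, and $$d(e_S)=\sum_{s\in S}(-1)^{|\{t\in S:\,t<s\}|}\,\frac{\operatorname{lcm}(x^{E_t}:t\in S)}{\operatorname{lcm}(x^{E_t}:t\in S\setminus\{s\})}\,e_{S\setminus\{s\}}.$$ Minimal means that every differential maps into $\mathfrak{m}$ times its target, where $\mathfrak{m}=(x_v:v\in V)$. (2) For all integers $i\ge 0$ and $j$, the graded Betti number $\beta_{i,j}(R/I(\mathcal{H}))=\dim_k\operatorname{Tor}_i^R(R/I(\mathcal{H}),k)_j$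 satisfies $$\beta_{i,j}(R/I(\mathcal{H}))=\Big|\Big\{S\subseteq\{1,\dots,n\} : |S|=i,\ \Big|\bigcup_{t\in S}E_t\Big|=j\Big\}\Big|=\Big|\Big\{\bigcup_{t\in S}E_t : S\subseteq\{1,\dots,n\},\ |S|=i,\ \Big|\bigcup_{t\in S}E_t\Big|=j\Big\}\Big|.$$ Here $\operatorname{Tor}_i^R(R/I(\mathcal{H}),k)_j$ is the degree $j$ part of $H_i(F\otimes_R k)$, where $F$ is any graded free resolution of $R/I(\mathcal{H})$. (3) For all $i\ge 0$, the total Betti number is $\beta_i(R/I(\mathcal{H}))=\dim_k\operatorname{Tor}_i^R(R/I(\mathcal{H}),k)=\binom{n}{i}$. -/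

import Mathlib

open scoped TensorProduct
open CategoryTheory

noncomputable section

namespace HypergraphBetti

universe u v w

/-! ## Hypergraphs and edge ideals -/

/-- A free vertex of a hypergraph is a vertex that lies in at most one edge. -/
def IsFreeVertex {V : Type v} (H : Hypergraph V) (x : V) : Prop :=
  x ∈ H.vertexSet ∧ {e | e ∈ H.edgeSet ∧ x ∈ e}.Subsingleton

/-- The independence complex of a hypergraph with vertex set all of `V`: the finite sets of vertices
that contain no edge. -/
def independenceComplex {V : Type v} (H : Hypergraph V) : Set (Finset V) :=
  {F | ∀ e ∈ H.edgeSet, ¬ e ⊆ (F : Set V)}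

/-- The squarefree monomial `x^F`, the product of the variables in `F`. -/
def squarefreeMonomial (k : Type u) [Field k] {V : Type v} (F : Finset V) : MvPolynomial V k :=
  ∏ x ∈ F, MvPolynomial.X x

/-- The Stanley-Reisner ideal, generated by the monomials of the nonfaces. -/
def stanleyReisnerIdeal (k : Type u) [Field k] {V : Type v} (Δ : Set (Finset V)) :
    Ideal (MvPolynomial V k) :=
  Ideal.span {f | ∃ F : Finset V, F ∉ Δ ∧ f = squarefreeMonomial k F}

/-- The edge ideal: the Stanley-Reisner ideal of the independence complex. -/
def edgeIdeal (k : Type u) [Field k] {V : Type v} (H : Hypergraph V) :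
    Ideal (MvPolynomial V k) :=
  stanleyReisnerIdeal k (independenceComplex H)

/-- The homogeneous maximal ideal, generated by the variables. -/
def maxIdeal (k : Type u) [Field k] (V : Type v) : Ideal (MvPolynomial V k) :=
  Ideal.span (Set.range MvPolynomial.X)

/-- The field `k` as a module over the polynomial ring `R`, namely `R/(all variables)`. -/
abbrev ResidueField (k : Type u) [Field k] (V : Type v) : Type (max u v) :=
  MvPolynomial V k ⧸ maxIdeal k V

/-! ## Total Betti numbers -/

/-- The `i`-th Betti number of `R/I`, the dimension over `k` of `Tor_i^R(R/I, k)`. It is computed by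
deriving `- ⊗ k` at `R/I`, and is a cardinal, so that it carries no default value. -/
def betti {k : Type u} [Field k] {V : Type v} (I : Ideal (MvPolynomial V k)) (i : ℕ) :
    Cardinal.{max u v} :=
  Module.rank k
    ((ModuleCat.restrictScalars (algebraMap k (MvPolynomial V k))).obj
      (((Tor' (ModuleCat.{max u v} (MvPolynomial V k)) i).obj
        (ModuleCat.of _ (MvPolynomial V k ⧸ I))).obj
        (ModuleCat.of _ (ResidueField k V))))

/-! ## Graded free resolutions and graded Betti numbers -/

/-- A sequence of maps `⋯ → F₂ → F₁ → F₀` of free modules over `R = k[V]`, where `F_i` has the basis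
`ι i` and the basis element `b` is put in degree `deg i b`. So `F_i` is the direct sum of the
shifted modules `R(-deg i b)`. -/
structure FreeSequence (k : Type u) [Field k] (V : Type v) where
  ι : ℕ → Type w
  deg : ∀ i, ι i → ℤ
  d : ∀ i, (ι (i + 1) →₀ MvPolynomial V k) →ₗ[MvPolynomial V k] (ι i →₀ MvPolynomial V k)

namespace FreeSequence

variable {k : Type u} [Field k] {V : Type v}

/-- `F` with the augmentation `ε : F₀ → R/I` is a graded free resolution of `R/I`: all maps are
homogeneous of degree zero, and `⋯ → F₁ → F₀ → R/I → 0` is exact. -/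
structure IsGradedResolution (F : FreeSequence.{u, v, w} k V) (I : Ideal (MvPolynomial V k))
    (ε : (F.ι 0 →₀ MvPolynomial V k) →ₗ[MvPolynomial V k] (MvPolynomial V k ⧸ I)) : Prop where
  d_homogeneous : ∀ (i : ℕ) (b : F.ι (i + 1)) (c : F.ι i),
    ∀ m ∈ (F.d i (Finsupp.single b 1) c).support, (m.degree : ℤ) + F.deg i c = F.deg (i + 1) b
  augmentation_homogeneous : ∀ b : F.ι 0, ∃ f : MvPolynomial V k,
    Ideal.Quotient.mk I f = ε (Finsupp.single b 1) ∧ ∀ m ∈ f.support, (m.degree : ℤ) = F.deg 0 b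
  exact_d : ∀ i : ℕ, Function.Exact (F.d (i + 1)) (F.d i)
  exact_augmentation : Function.Exact (F.d 0) ε
  surjective_augmentation : Function.Surjective ε

/-- `F` is minimal: every differential maps into `𝔪 F`. -/
def IsMinimal (F : FreeSequence.{u, v, w} k V) : Prop :=
  ∀ i : ℕ, LinearMap.range (F.d i) ≤
    maxIdeal k V • (⊤ : Submodule (MvPolynomial V k) (F.ι i →₀ MvPolynomial V k))

/-- The module `F_i ⊗_R k`. -/
def tensor (F : FreeSequence.{u, v, w} k V) (i : ℕ) : Type (max u v w) :=
  (F.ι i →₀ MvPolynomial V k) ⊗[MvPolynomial V k] ResidueField k V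

instance (F : FreeSequence.{u, v, w} k V) (i : ℕ) : AddCommGroup (F.tensor i) :=
  inferInstanceAs (AddCommGroup ((F.ι i →₀ MvPolynomial V k) ⊗[MvPolynomial V k] ResidueField k V))

instance (F : FreeSequence.{u, v, w} k V) (i : ℕ) : Module (MvPolynomial V k) (F.tensor i) :=
  inferInstanceAs (Module (MvPolynomial V k)
    ((F.ι i →₀ MvPolynomial V k) ⊗[MvPolynomial V k] ResidueField k V))

instance (F : FreeSequence.{u, v, w} k V) (i : ℕ) : Module k (F.tensor i) :=
  inferInstanceAs (Module k ((F.ι i →₀ MvPolynomial V k) ⊗[MvPolynomial V k] ResidueField k V))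

instance (F : FreeSequence.{u, v, w} k V) (i : ℕ) :
    IsScalarTower k (MvPolynomial V k) (F.tensor i) :=
  inferInstanceAs (IsScalarTower k (MvPolynomial V k)
    ((F.ι i →₀ MvPolynomial V k) ⊗[MvPolynomial V k] ResidueField k V))

/-- The differential of `F ⊗_R k`. -/
def tensorD (F : FreeSequence.{u, v, w} k V) (i : ℕ) : F.tensor (i + 1) →ₗ[k] F.tensor i :=
  ((F.d i).rTensor (ResidueField k V)).restrictScalars k

/-- The part of degree `j` of `F_i ⊗_R k`. As `k` sits in degree zero, it is spanned by the basis
elements of degree `j`. -/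
def tensorPiece (F : FreeSequence.{u, v, w} k V) (i : ℕ) (j : ℤ) : Submodule k (F.tensor i) :=
  Submodule.span k {t | ∃ b : F.ι i, F.deg i b = j ∧ t = Finsupp.single b 1 ⊗ₜ[MvPolynomial V k] 1}

/-- The cycles of `F ⊗_R k`. -/
def cycles (F : FreeSequence.{u, v, w} k V) : ∀ i : ℕ, Submodule k (F.tensor i)
  | 0 => ⊤
  | i + 1 => LinearMap.ker (F.tensorD i)

/-- The part of degree `j` of `H_i(F ⊗_R k)`. For a graded free resolution `F` of `R/I` it is the
part of degree `j` of `Tor_i^R(R/I, k)`. -/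
abbrev torPiece (F : FreeSequence.{u, v, w} k V) (i : ℕ) (j : ℤ) : Type (max u v w) :=
  ↥(F.cycles i ⊓ F.tensorPiece i j) ⧸
    ((F.tensorPiece (i + 1) j).map (F.tensorD i)).submoduleOf (F.cycles i ⊓ F.tensorPiece i j)

/-- The graded Betti number `β_{i,j}` that the graded resolution `F` computes. -/
def gradedBetti (F : FreeSequence.{u, v, w} k V) (i : ℕ) (j : ℤ) : Cardinal.{max u v w} :=
  Module.rank k (F.torPiece i j)

end FreeSequence

/-! ## The Taylor resolution -/

/-- The least common multiple of the monomials `x^{a t}`, for `t` in `S`, as an exponent vector. -/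
def lcmExponent {V : Type v} {n : ℕ} (a : Fin n → V →₀ ℕ) (S : Finset (Fin n)) : V →₀ ℕ :=
  S.sup a

/-- The Taylor differential on the basis elements `e_S`, one for each `(i+1)`-element set `S` of
indices: `d e_S` is the sum over `s` in `S` of
`(-1)^{#{t ∈ S, t < s}} (lcm(S) / lcm(S \ s)) e_{S \ s}`. -/
def taylorD (k : Type u) [Field k] {V : Type v} {n : ℕ} (a : Fin n → V →₀ ℕ) (i : ℕ) :
    ({S : Finset (Fin n) // S.card = i + 1} →₀ MvPolynomial V k) →ₗ[MvPolynomial V k]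
      ({S : Finset (Fin n) // S.card = i} →₀ MvPolynomial V k) :=
  Finsupp.linearCombination (MvPolynomial V k) fun S =>
    ∑ s : {s // s ∈ S.1},
      Finsupp.single ⟨S.1.erase s.1, by rw [Finset.card_erase_of_mem s.2, S.2]; rfl⟩
        (MvPolynomial.monomial (lcmExponent a S.1 - lcmExponent a (S.1.erase s.1))
          ((-1 : k) ^ (S.1.filter (fun t => t < s.1)).card))

/-- The Taylor complex of the monomials `x^{a 1}, …, x^{a n}`. It has in homological degree `i` the
basis elements `e_S`, one for each `i`-element set `S` of indices, where `e_S` has the degree of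
`lcm(S)`. -/
def taylor (k : Type u) [Field k] {V : Type v} {n : ℕ} (a : Fin n → V →₀ ℕ) :
    FreeSequence.{u, v, 0} k V where
  ι i := {S : Finset (Fin n) // S.card = i}
  deg _ S := ((lcmExponent a S.1).degree : ℤ)
  d := taylorD k a

/-- The augmentation of the Taylor complex, with `e_∅ ↦ 1`. -/
def taylorAugmentation {k : Type u} [Field k] {V : Type v} {n : ℕ} (a : Fin n → V →₀ ℕ)
    (I : Ideal (MvPolynomial V k)) :
    ((taylor k a).ι 0 →₀ MvPolynomial V k) →ₗ[MvPolynomial V k] (MvPolynomial V k ⧸ I) :=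
  Finsupp.linearCombination (MvPolynomial V k) fun _ => 1

/-- The exponent vector of the squarefree monomial `x^F`. -/
def squarefreeExponent {V : Type v} (F : Finset V) : V →₀ ℕ :=
  ∑ x ∈ F, Finsupp.single x 1

end HypergraphBetti

end

open HypergraphBetti

universe u v w

/-!
Write `R = k[V]`. Three independent facts carry the theorem.

*The Taylor complex of any monomials `x^{a 1}, …, x^{a n}` resolves `R/I`, for the ideal `I` that they
generate.* In a fixed multidegree `α` the complex has the basis `x^{α - lcm(S)} e_S`
(`strandElement`), for the sets `S` with `lcm(S) ∣ x^α`, and the differential only has the signs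
left: it is the augmented simplicial chain complex of the full simplex on `{t | x^{a t} ∣ x^α}`. If
this set is nonempty, coning off its least element is a contraction (`taylorCone`,
`taylorD_taylorCone_add`). With the least element as apex, no sign enters the cone.

*A free vertex in every edge makes the Taylor complex minimal.* The free vertex of `E s` lies in the
union of the edges `E t`, for `t` in `S`, exactly if `s` is in `S`. So omitting an index from `S` makes
the least common multiple smaller, and no matrix entry of the differential is a unit
(`taylor_isMinimal_of_exists_mem_only`). The same vertices show that `S` is determined by the union
of its edges (`biUnion_injective_of_exists_mem_only`).

*A minimal resolution computes `Tor`.* For an arbitrary graded free resolution `F`, homogeneous chain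
maps between `F` and the Taylor complex exist in both directions, and both composites are
homogeneously homotopic to the identity; all this rests on the lifting property
`IsHomogeneousMap.exists_lift`. After tensoring with `k` the differentials of the Taylor complex
vanish, so `H_i(F ⊗ k)_j` is the span of the `e_S ⊗ 1` with `|S| = i` and `deg lcm(S) = j`
(`FreeSequence.IsComparison.nonempty_torPiece_equiv`). The total Betti numbers come from viewing the
Taylor complex as a projective resolution in the category of modules (`torIsoOfExact`).
-/

namespace HypergraphBetti

/-! ### Exactness of the Taylor complex -/

section Taylor

variable (k : Type u) [Field k] {V : Type v} {n : ℕ} (a : Fin n → V →₀ ℕ)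

lemma lcmExponent_mono {S T : Finset (Fin n)} (h : S ⊆ T) : lcmExponent a S ≤ lcmExponent a T :=
  Finset.sup_mono h

/-- The sign `(-1)^{#{t ∈ S, t < s}}`. -/
def taylorSign (S : Finset (Fin n)) (s : Fin n) : k :=
  (-1) ^ (S.filter (fun t => t < s)).card

lemma taylorSign_erase_of_not_lt {S : Finset (Fin n)} {r s : Fin n} (h : ¬ r < s) :
    taylorSign k (S.erase r) s = taylorSign k S s := by
  unfold taylorSign
  rw [Finset.filter_erase, Finset.erase_eq_of_notMem (by simp [h])]

lemma taylorSign_erase_of_lt {S : Finset (Fin n)} {r s : Fin n} (hr : r ∈ S) (h : r < s) :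
    taylorSign k (S.erase r) s = -taylorSign k S s := by
  unfold taylorSign
  rw [Finset.filter_erase,
    ← Finset.card_erase_add_one (s := S.filter (fun t => t < s)) (a := r) (by simp [h, hr]),
    pow_succ]
  ring

lemma taylorSign_of_forall_le {S : Finset (Fin n)} {t : Fin n} (h : ∀ s ∈ S, t ≤ s) :
    taylorSign k S t = 1 := by
  unfold taylorSign
  rw [Finset.filter_eq_empty_iff.2 (fun s hs => (h s hs).not_gt)]
  simp

/-- Removing two indices in either order gives opposite signs. -/
lemma taylorSign_mul_erase {S : Finset (Fin n)} {r s : Fin n} (hr : r ∈ S) (hs : s ∈ S)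
    (hrs : r ≠ s) :
    taylorSign k S s * taylorSign k (S.erase s) r =
      -(taylorSign k S r * taylorSign k (S.erase r) s) := by
  rcases lt_or_gt_of_ne hrs with h | h
  · rw [taylorSign_erase_of_not_lt k h.not_gt, taylorSign_erase_of_lt k hr h]
    ring
  · rw [taylorSign_erase_of_not_lt k h.not_gt, taylorSign_erase_of_lt k hs h]
    ring

/-- The element `x^{α - lcm(S)} e_S` of multidegree `α` of the Taylor complex. It is zero if `S` does
not have `i` elements, which keeps sums over subsets free of cardinality proofs. -/
noncomputable def strandElement (i : ℕ) (α : V →₀ ℕ) (S : Finset (Fin n)) :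
    {S : Finset (Fin n) // S.card = i} →₀ MvPolynomial V k :=
  if h : S.card = i then
    Finsupp.single ⟨S, h⟩ (MvPolynomial.monomial (α - lcmExponent a S) 1) else 0

lemma strandElement_of_card {i : ℕ} (α : V →₀ ℕ) {S : Finset (Fin n)} (h : S.card = i) :
    strandElement k a i α S =
      Finsupp.single ⟨S, h⟩ (MvPolynomial.monomial (α - lcmExponent a S) 1) :=
  dif_pos h

lemma strandElement_of_card_ne {i : ℕ} (α : V →₀ ℕ) {S : Finset (Fin n)} (h : S.card ≠ i) :
    strandElement k a i α S = 0 :=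
  dif_neg h

/-- On elements of multidegree `α` the monomial coefficients of the Taylor differential
disappear, and only the signs are left. -/
lemma taylorD_strandElement (i : ℕ) {α : V →₀ ℕ} {S : Finset (Fin n)}
    (hα : lcmExponent a S ≤ α) :
    taylorD k a i (strandElement k a (i + 1) α S) =
      ∑ s ∈ S, taylorSign k S s • strandElement k a i α (S.erase s) := by
  by_cases hS : S.card = i + 1
  · rw [strandElement_of_card k a α hS, taylorD, Finsupp.linearCombination_single,
      Finset.smul_sum, ← Finset.sum_coe_sort S]
    refine Finset.sum_congr rfl fun s _ => ?_
    rw [strandElement_of_card k a α (S := S.erase s.1)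
      (by rw [Finset.card_erase_of_mem s.2, hS]; rfl)]
    simp only [Finsupp.smul_single, smul_eq_mul, MvPolynomial.monomial_mul, one_mul,
      MvPolynomial.smul_monomial, mul_one]
    rw [tsub_add_tsub_cancel hα (lcmExponent_mono a (Finset.erase_subset _ _))]
    rfl
  · rw [strandElement_of_card_ne k a α hS, map_zero]
    refine (Finset.sum_eq_zero fun s hs => ?_).symm
    rw [strandElement_of_card_ne, smul_zero]
    have := Finset.card_erase_add_one hs
    omega

/-- The elements of the strands span the Taylor complex over the field. -/
lemma strandElement_ext {i : ℕ} {M : Type*} [AddCommMonoid M] [Module k M]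
    {f g : ({S : Finset (Fin n) // S.card = i} →₀ MvPolynomial V k) →ₗ[k] M}
    (h : ∀ (α : V →₀ ℕ) (S : Finset (Fin n)), S.card = i → lcmExponent a S ≤ α →
      f (strandElement k a i α S) = g (strandElement k a i α S)) : f = g := by
  refine Finsupp.lhom_ext' fun S => MvPolynomial.linearMap_ext fun m => LinearMap.ext_ring ?_
  have := h (m + lcmExponent a S.1) S.1 S.2 le_add_self
  rw [strandElement_of_card k a _ S.2, add_tsub_cancel_right] at this
  exact this

/-- The Taylor differential squares to zero: removing two indices in either order gives the same
element with opposite signs, so the terms cancel in pairs. -/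
lemma taylorD_comp_taylorD (i : ℕ)
    (x : {S : Finset (Fin n) // S.card = i + 1 + 1} →₀ MvPolynomial V k) :
    taylorD k a i (taylorD k a (i + 1) x) = 0 := by
  have key : ((taylorD k a i ∘ₗ taylorD k a (i + 1)).restrictScalars k) = 0 := by
    refine strandElement_ext k a fun α S _ hα => ?_
    have hα' (s : Fin n) : lcmExponent a (S.erase s) ≤ α :=
      (lcmExponent_mono a (Finset.erase_subset _ _)).trans hα
    have hk (c : k) (y : {S : Finset (Fin n) // S.card = i + 1} →₀ MvPolynomial V k) :
        taylorD k a i (c • y) = c • taylorD k a i y :=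
      ((taylorD k a i).restrictScalars k).map_smul c y
    simp only [LinearMap.restrictScalars_apply, LinearMap.comp_apply,
      taylorD_strandElement k a _ hα, map_sum, hk, taylorD_strandElement k a _ (hα' _),
      Finset.smul_sum, smul_smul, LinearMap.zero_apply]
    rw [Finset.sum_sigma']
    refine Finset.sum_involution (fun x _ => ⟨x.2, x.1⟩) ?_ ?_ ?_ ?_
    · rintro ⟨s, r⟩ hx
      simp only [Finset.mem_sigma, Finset.mem_erase] at hx
      simp only
      rw [taylorSign_mul_erase k hx.2.2 hx.1 hx.2.1, Finset.erase_right_comm, neg_smul,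
        neg_add_cancel]
    · rintro ⟨s, r⟩ hx _ h
      simp only [Finset.mem_sigma, Finset.mem_erase] at hx
      simp only [Sigma.mk.injEq] at h
      exact hx.2.1 h.1
    · rintro ⟨s, r⟩ hx
      simp only [Finset.mem_sigma, Finset.mem_erase] at hx ⊢
      exact ⟨hx.2.2, hx.2.1.symm, hx.1⟩
    · rintro ⟨s, r⟩ hx
      rfl
  exact LinearMap.congr_fun key x

open Classical in
/-- The `k`-linear contracting homotopy of the Taylor complex. In multidegree `α` it inserts into
`S` the least index `t` with `x^{a t} ∣ x^α`, if `t` is not in `S`. -/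
noncomputable def taylorCone (i : ℕ) :
    ({S : Finset (Fin n) // S.card = i} →₀ MvPolynomial V k) →ₗ[k]
      ({S : Finset (Fin n) // S.card = i + 1} →₀ MvPolynomial V k) :=
  Finsupp.lsum k fun S => (MvPolynomial.basisMonomials V k).constr k fun m =>
    if h : ∃ t, IsLeast {t | a t ≤ m + lcmExponent a S.1} t then
      if h.choose ∈ S.1 then 0
      else strandElement k a (i + 1) (m + lcmExponent a S.1) (insert h.choose S.1)
    else 0

lemma taylorCone_strandElement (i : ℕ) {α : V →₀ ℕ} {S : Finset (Fin n)}
    (hα : lcmExponent a S ≤ α) {t : Fin n} (ht : IsLeast {t | a t ≤ α} t) :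
    taylorCone k a i (strandElement k a i α S) =
      if t ∈ S then 0 else strandElement k a (i + 1) α (insert t S) := by
  by_cases hS : S.card = i
  · have hex : ∃ t, IsLeast {t | a t ≤ α} t := ⟨t, ht⟩
    have hc : hex.choose = t := hex.choose_spec.unique ht
    rw [strandElement_of_card k a α hS, taylorCone, Finsupp.lsum_single,
      ← congrFun (MvPolynomial.coe_basisMonomials V k) (α - lcmExponent a S),
      Module.Basis.constr_basis]
    rw [tsub_add_cancel_of_le hα, dif_pos hex, hc]
  · rw [strandElement_of_card_ne k a α hS, map_zero]
    split_ifs with h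
    · rfl
    · rw [strandElement_of_card_ne]
      rw [Finset.card_insert_of_notMem h]
      omega

/-- In positive homological degrees the cone contracts the Taylor complex, `d h + h d = 1`. -/
lemma taylorD_taylorCone_add (i : ℕ)
    (x : {S : Finset (Fin n) // S.card = i + 1} →₀ MvPolynomial V k) :
    taylorD k a (i + 1) (taylorCone k a (i + 1) x) + taylorCone k a i (taylorD k a i x) = x := by
  have key : ((taylorD k a (i + 1)).restrictScalars k) ∘ₗ taylorCone k a (i + 1) +
      taylorCone k a i ∘ₗ ((taylorD k a i).restrictScalars k) = LinearMap.id := by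
    refine strandElement_ext k a fun α S hS hα => ?_
    -- `S` is nonempty, so some `x^{a t}` divides `x^α`
    obtain ⟨s₀, hs₀⟩ : S.Nonempty := Finset.card_pos.1 (by omega)
    have hle : ∀ s ∈ S, a s ≤ α := fun s hs => (Finset.le_sup (f := a) hs).trans hα
    obtain ⟨t, ht⟩ : ∃ t, IsLeast {t | a t ≤ α} t :=
      ⟨_, (wellFounded_lt.min_mem {t | a t ≤ α} ⟨s₀, hle s₀ hs₀⟩),
        fun s hs => wellFounded_lt.min_le hs⟩
    have htS : ∀ s ∈ S, t ≤ s := fun s hs => ht.2 (hle s hs)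
    have hα' (s : Fin n) : lcmExponent a (S.erase s) ≤ α :=
      (lcmExponent_mono a (Finset.erase_subset _ _)).trans hα
    simp only [LinearMap.add_apply, LinearMap.comp_apply, LinearMap.restrictScalars_apply,
      LinearMap.id_apply, taylorD_strandElement k a _ hα, map_sum, map_smul,
      taylorCone_strandElement k a _ hα ht, taylorCone_strandElement k a _ (hα' _) ht]
    by_cases h : t ∈ S
    -- `h` kills `e_S` and all terms of `d e_S` that contain `t`; it maps `e_{S \ t}` back to `e_S`
    · rw [if_pos h, map_zero, zero_add, Finset.sum_eq_single t]
      · rw [taylorSign_of_forall_le k htS, one_smul, if_neg (by simp), Finset.insert_erase h]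
      · intro s _ hst
        rw [if_pos (Finset.mem_erase.2 ⟨hst.symm, h⟩), smul_zero]
      · exact fun h' => absurd h h'
    -- the terms of `d e_{S ∪ t}` other than `e_S` cancel those of `h (d e_S)`
    · have hins : lcmExponent a (insert t S) ≤ α := by
        unfold lcmExponent
        rw [Finset.sup_insert]
        exact sup_le ht.1 hα
      rw [if_neg h, taylorD_strandElement k a _ hins, Finset.sum_insert h,
        Finset.erase_insert h, taylorSign_of_forall_le k (by simpa using htS), one_smul,
        add_assoc, ← Finset.sum_add_distrib, Finset.sum_eq_zero, add_zero]
      intro s hs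
      have hts : t ≠ s := fun e => h (e ▸ hs)
      have hlt : t < s := lt_of_le_of_ne (htS s hs) hts
      have hsign : taylorSign k S s = -taylorSign k (insert t S) s := by
        rw [← taylorSign_erase_of_lt k (Finset.mem_insert_self t S) hlt, Finset.erase_insert h]
      rw [if_neg (fun h' => h (Finset.mem_of_mem_erase h')), hsign,
        Finset.erase_insert_of_ne hts, neg_smul, add_neg_cancel]
  exact LinearMap.congr_fun key x

/-- Exactness of the Taylor complex in positive homological degrees. -/
lemma taylorD_exact (i : ℕ) : Function.Exact (taylorD k a (i + 1)) (taylorD k a i) := by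
  intro x
  constructor
  · intro hx
    refine ⟨taylorCone k a (i + 1) x, ?_⟩
    have := taylorD_taylorCone_add k a i x
    rwa [hx, map_zero, add_zero] at this
  · rintro ⟨y, rfl⟩
    exact taylorD_comp_taylorD k a i y

lemma taylorD_strandElement_singleton (t : Fin n) {α : V →₀ ℕ} (h : a t ≤ α) :
    taylorD k a 0 (strandElement k a 1 α {t}) = strandElement k a 0 α ∅ := by
  rw [taylorD_strandElement k a 0 (by simpa [lcmExponent] using h), Finset.sum_singleton,
    taylorSign_of_forall_le k (by simp), one_smul, Finset.erase_singleton]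

/-- The monomials that occur in the matrix entries of the Taylor differential. -/
lemma exists_of_mem_support_taylorD {i : ℕ} (S : {S : Finset (Fin n) // S.card = i + 1})
    (T : {S : Finset (Fin n) // S.card = i}) {m : V →₀ ℕ}
    (hm : m ∈ (taylorD k a i (Finsupp.single S 1) T).support) :
    ∃ s ∈ S.1, T.1 = S.1.erase s ∧ m = lcmExponent a S.1 - lcmExponent a (S.1.erase s) := by
  classical
  rw [taylorD, Finsupp.linearCombination_single, one_smul, Finsupp.finsetSum_apply] at hm
  obtain ⟨s, -, hs⟩ := Finset.mem_biUnion.1 (MvPolynomial.support_sum hm)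
  rw [Finsupp.single_apply] at hs
  split_ifs at hs with hT
  · exact ⟨s.1, s.2, hT ▸ rfl, Finset.mem_singleton.1 (MvPolynomial.support_monomial_subset hs)⟩
  · simp at hs

lemma taylorAugmentation_apply (I : Ideal (MvPolynomial V k))
    (x : {S : Finset (Fin n) // S.card = 0} →₀ MvPolynomial V k) :
    taylorAugmentation a I x = Ideal.Quotient.mk I (x ⟨∅, Finset.card_empty⟩) := by
  have : (Finsupp.linearCombination (MvPolynomial V k)
        fun _ : {S : Finset (Fin n) // S.card = 0} => (1 : MvPolynomial V k ⧸ I)) =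
      (Submodule.mkQ I) ∘ₗ Finsupp.lapply ⟨∅, Finset.card_empty⟩ := by
    refine Finsupp.lhom_ext' fun S => LinearMap.ext_ring ?_
    obtain rfl : S = ⟨∅, Finset.card_empty⟩ := Subtype.ext (Finset.card_eq_zero.1 S.2)
    simp
  exact LinearMap.congr_fun this x

variable {k} in
/-- Exactness of the Taylor complex at `R`: its image there is the ideal of the monomials. -/
lemma taylorD_exact_augmentation {I : Ideal (MvPolynomial V k)}
    (hI : I = Ideal.span (Set.range fun t => MvPolynomial.monomial (a t) (1 : k)))
    (x : {S : Finset (Fin n) // S.card = 0} →₀ MvPolynomial V k) :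
    x ⟨∅, Finset.card_empty⟩ ∈ I ↔ x ∈ LinearMap.range (taylorD k a 0) := by
  constructor
  · intro hx
    have hle : I ≤ (LinearMap.range (taylorD k a 0)).comap
        (Finsupp.lsingle (⟨∅, Finset.card_empty⟩ : {S : Finset (Fin n) // S.card = 0})) := by
      rw [hI]
      refine Submodule.span_le.2 ?_
      rintro _ ⟨t, rfl⟩
      refine ⟨strandElement k a 1 (a t) {t}, ?_⟩
      rw [taylorD_strandElement_singleton k a t le_rfl, strandElement_of_card k a _ Finset.card_empty]
      simp [lcmExponent, bot_eq_zero]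
    have hx' : x = Finsupp.single ⟨∅, Finset.card_empty⟩ (x ⟨∅, Finset.card_empty⟩) := by
      ext1 S
      obtain rfl : S = ⟨∅, Finset.card_empty⟩ := Subtype.ext (Finset.card_eq_zero.1 S.2)
      simp
    rw [hx']
    exact hle hx
  · rintro ⟨y, rfl⟩
    induction y using Finsupp.induction_linear with
    | zero => simp
    | add f g hf hg =>
      rw [map_add, Finsupp.add_apply]
      exact I.add_mem hf hg
    | single S f =>
      obtain ⟨t, ht⟩ := Finset.card_eq_one.1 S.2
      obtain rfl : S = ⟨{t}, Finset.card_singleton t⟩ := Subtype.ext ht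
      have h := taylorD_strandElement_singleton k a t le_rfl
      rw [strandElement_of_card k a _ (Finset.card_singleton t),
        strandElement_of_card k a _ Finset.card_empty] at h
      simp only [lcmExponent, Finset.sup_singleton, tsub_self, Finset.sup_empty, bot_eq_zero,
        tsub_zero, MvPolynomial.monomial_zero', map_one] at h
      rw [← mul_one f, ← smul_eq_mul, ← Finsupp.smul_single, map_smul]
      erw [h]
      rw [Finsupp.smul_apply, Finsupp.single_eq_same, hI]
      exact Ideal.mul_mem_left _ _ (Ideal.subset_span ⟨t, rfl⟩)

/-- The Taylor complex of arbitrary monomials is a graded free resolution. -/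
theorem taylor_isGradedResolution (I : Ideal (MvPolynomial V k))
    (hI : I = Ideal.span (Set.range fun t => MvPolynomial.monomial (a t) (1 : k))) :
    (taylor k a).IsGradedResolution I (taylorAugmentation a I) where
  d_homogeneous i S T m hm := by
    obtain ⟨s, -, hT, rfl⟩ := exists_of_mem_support_taylorD k a S T hm
    change ((lcmExponent a S.1 - _ : V →₀ ℕ).degree : ℤ) + (lcmExponent a T.1).degree =
      (lcmExponent a S.1).degree
    rw [hT, ← Nat.cast_add, ← map_add,
      tsub_add_cancel_of_le (lcmExponent_mono a (Finset.erase_subset _ _))]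
  augmentation_homogeneous S := by
    refine ⟨1, ?_, ?_⟩
    · exact (taylorAugmentation_apply k a I (Finsupp.single S 1)).symm ▸ (by
        obtain rfl : S = (⟨∅, Finset.card_empty⟩ : {S : Finset (Fin n) // S.card = 0}) :=
          Subtype.ext (Finset.card_eq_zero.1 S.2)
        exact congrArg _ Finsupp.single_eq_same.symm)
    · intro m hm
      have hm0 : m = 0 := Finset.mem_singleton.1
        (MvPolynomial.support_monomial_subset (s := 0) (a := (1 : k)) hm)
      have hS : S.1 = ∅ := Finset.card_eq_zero.1 S.2
      change (m.degree : ℤ) = (lcmExponent a S.1).degree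
      rw [hm0, hS, lcmExponent, Finset.sup_empty, bot_eq_zero]
  exact_d i := taylorD_exact k a i
  exact_augmentation x := by
    refine Iff.trans ?_ (taylorD_exact_augmentation a hI x)
    refine (Eq.congr_left (taylorAugmentation_apply k a I x)).trans ?_
    exact Ideal.Quotient.eq_zero_iff_mem
  surjective_augmentation y := by
    obtain ⟨f, rfl⟩ := Ideal.Quotient.mk_surjective y
    refine ⟨Finsupp.single (⟨∅, Finset.card_empty⟩ : {S : Finset (Fin n) // S.card = 0}) f, ?_⟩
    refine (taylorAugmentation_apply k a I _).trans ?_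
    exact congrArg _ Finsupp.single_eq_same

end Taylor

/-! ### Homogeneous maps of graded free modules -/

section Graded

variable {k : Type u} [Field k] {V : Type v} {ι κ μ : Type*}

/-- The element `y` of the graded free module with basis `κ`, whose basis elements are put in the
degrees `q`, is homogeneous of degree `j`. -/
def IsHomogeneousElement (q : κ → ℤ) (j : ℤ) (y : κ →₀ MvPolynomial V k) : Prop :=
  ∀ c, ∀ m ∈ (y c).support, (m.degree : ℤ) + q c = j

/-- The linear map `φ` of graded free modules is homogeneous of degree zero. -/
def IsHomogeneousMap (p : ι → ℤ) (q : κ → ℤ)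
    (φ : (ι →₀ MvPolynomial V k) →ₗ[MvPolynomial V k] (κ →₀ MvPolynomial V k)) : Prop :=
  ∀ b, IsHomogeneousElement q (p b) (φ (Finsupp.single b 1))

lemma IsHomogeneousElement.sub {q : κ → ℤ} {j : ℤ} {x y : κ →₀ MvPolynomial V k}
    (hx : IsHomogeneousElement q j x) (hy : IsHomogeneousElement q j y) :
    IsHomogeneousElement q j (x - y) := by
  classical
  intro c m hm
  rw [Finsupp.sub_apply] at hm
  rcases Finset.mem_union.1 (MvPolynomial.support_sub _ _ _ hm) with h | h
  · exact hx c m h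
  · exact hy c m h

lemma isHomogeneousElement_single (q : κ → ℤ) (c : κ) :
    IsHomogeneousElement q (q c) (Finsupp.single c (1 : MvPolynomial V k)) := by
  classical
  intro c' m hm
  rw [Finsupp.single_apply] at hm
  split_ifs at hm with h
  · subst h
    have hm0 : m = 0 := Finset.mem_singleton.1
      (MvPolynomial.support_monomial_subset (s := 0) (a := (1 : k)) hm)
    simp [hm0]
  · simp at hm

/-- The component of degree `j` of an element of a graded free module. -/
noncomputable def gradedPart (q : κ → ℤ) (j : ℤ) :
    (κ →₀ MvPolynomial V k) →ₗ[k] (κ →₀ MvPolynomial V k) :=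
  Finsupp.lsum k fun c => Finsupp.lsingle c ∘ₗ
    (if 0 ≤ j - q c then MvPolynomial.homogeneousComponent (j - q c).toNat else 0)

lemma coeff_gradedPart (q : κ → ℤ) (j : ℤ) (y : κ →₀ MvPolynomial V k) (c : κ) (m : V →₀ ℕ) :
    (gradedPart q j y c).coeff m = if (m.degree : ℤ) + q c = j then (y c).coeff m else 0 := by
  classical
  induction y using Finsupp.induction_linear with
  | zero => simp
  | add f g hf hg =>
    rw [map_add, Finsupp.add_apply, MvPolynomial.coeff_add, hf, hg, Finsupp.add_apply,
      MvPolynomial.coeff_add]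
    split_ifs <;> simp
  | single b f =>
    rw [gradedPart, Finsupp.lsum_single, LinearMap.comp_apply, Finsupp.lsingle_apply,
      Finsupp.single_apply, Finsupp.single_apply]
    by_cases hb : b = c
    · subst hb
      rw [if_pos rfl, if_pos rfl]
      by_cases h : 0 ≤ j - q b
      · rw [if_pos h, MvPolynomial.coeff_homogeneousComponent]
        refine if_congr ?_ rfl rfl
        omega
      · rw [if_neg h, if_neg (by omega)]
        simp
    · simp [hb]

lemma isHomogeneousElement_gradedPart (q : κ → ℤ) (j : ℤ) (y : κ →₀ MvPolynomial V k) :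
    IsHomogeneousElement q j (gradedPart q j y) := by
  intro c m hm
  rw [MvPolynomial.mem_support_iff, coeff_gradedPart] at hm
  by_contra h
  exact hm (if_neg h)

lemma IsHomogeneousElement.gradedPart_eq {q : κ → ℤ} {j : ℤ} {y : κ →₀ MvPolynomial V k}
    (hy : IsHomogeneousElement q j y) (j' : ℤ) :
    gradedPart q j' y = if j = j' then y else 0 := by
  ext c m
  rw [coeff_gradedPart]
  by_cases hm : (y c).coeff m = 0
  · split_ifs <;> simp [hm]
  · rw [hy c m (MvPolynomial.mem_support_iff.2 hm)]
    split_ifs <;> simp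

/-- Homogeneous maps commute with taking the component of a given degree. -/
lemma IsHomogeneousMap.map_gradedPart {p : ι → ℤ} {q : κ → ℤ}
    {φ : (ι →₀ MvPolynomial V k) →ₗ[MvPolynomial V k] (κ →₀ MvPolynomial V k)}
    (hφ : IsHomogeneousMap p q φ) (j : ℤ) (x : ι →₀ MvPolynomial V k) :
    φ (gradedPart p j x) = gradedPart q j (φ x) := by
  classical
  have key : φ.restrictScalars k ∘ₗ gradedPart p j = gradedPart q j ∘ₗ φ.restrictScalars k := by
    refine Finsupp.lhom_ext' fun b => MvPolynomial.linearMap_ext fun m => LinearMap.ext_ring ?_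
    have hx : IsHomogeneousElement p (m.degree + p b)
        (Finsupp.single b (MvPolynomial.monomial m (1 : k))) := by
      intro c m' hm'
      rw [Finsupp.single_apply] at hm'
      split_ifs at hm' with h
      · rw [← h, Finset.mem_singleton.1 (MvPolynomial.support_monomial_subset hm')]
      · simp at hm'
    have hy : IsHomogeneousElement q (m.degree + p b)
        (φ (Finsupp.single b (MvPolynomial.monomial m (1 : k)))) := by
      intro c m' hm'
      rw [← mul_one (MvPolynomial.monomial m (1 : k)), ← smul_eq_mul, ← Finsupp.smul_single,
        map_smul, Finsupp.smul_apply, smul_eq_mul] at hm'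
      obtain ⟨m₁, h₁, m₂, h₂, rfl⟩ := Finset.mem_add.1 (MvPolynomial.support_mul _ _ hm')
      rw [Finset.mem_singleton.1 (MvPolynomial.support_monomial_subset h₁), map_add,
        ← hφ b c m₂ h₂]
      push_cast
      ring
    simp only [LinearMap.comp_apply, LinearMap.restrictScalars_apply, Finsupp.lsingle_apply,
      hx.gradedPart_eq, hy.gradedPart_eq]
    split_ifs
    · rfl
    · exact map_zero φ
  exact LinearMap.congr_fun key x

lemma IsHomogeneousMap.map {p : ι → ℤ} {q : κ → ℤ}
    {φ : (ι →₀ MvPolynomial V k) →ₗ[MvPolynomial V k] (κ →₀ MvPolynomial V k)}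
    (hφ : IsHomogeneousMap p q φ) {j : ℤ} {x : ι →₀ MvPolynomial V k}
    (hx : IsHomogeneousElement p j x) : IsHomogeneousElement q j (φ x) := by
  have h := hφ.map_gradedPart j x
  rw [hx.gradedPart_eq, if_pos rfl] at h
  rw [h]
  exact isHomogeneousElement_gradedPart q j _

lemma IsHomogeneousMap.comp {p : ι → ℤ} {q : κ → ℤ} {r : μ → ℤ}
    {ψ : (κ →₀ MvPolynomial V k) →ₗ[MvPolynomial V k] (μ →₀ MvPolynomial V k)}
    {φ : (ι →₀ MvPolynomial V k) →ₗ[MvPolynomial V k] (κ →₀ MvPolynomial V k)}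
    (hψ : IsHomogeneousMap q r ψ) (hφ : IsHomogeneousMap p q φ) :
    IsHomogeneousMap p r (ψ ∘ₗ φ) :=
  fun b => hψ.map (hφ b)

lemma IsHomogeneousMap.sub {p : ι → ℤ} {q : κ → ℤ}
    {φ ψ : (ι →₀ MvPolynomial V k) →ₗ[MvPolynomial V k] (κ →₀ MvPolynomial V k)}
    (hφ : IsHomogeneousMap p q φ) (hψ : IsHomogeneousMap p q ψ) :
    IsHomogeneousMap p q (φ - ψ) :=
  fun b => (hφ b).sub (hψ b)

lemma isHomogeneousMap_id (p : ι → ℤ) :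
    IsHomogeneousMap p p (LinearMap.id : (ι →₀ MvPolynomial V k) →ₗ[MvPolynomial V k] _) :=
  fun b => isHomogeneousElement_single p b

/-- Graded free modules are projective among graded free modules: a homogeneous map `φ` lifts along
a homogeneous map `d` whose range contains that of `φ`. -/
lemma IsHomogeneousMap.exists_lift {p : ι → ℤ} {q : κ → ℤ} {r : μ → ℤ}
    {φ : (ι →₀ MvPolynomial V k) →ₗ[MvPolynomial V k] (κ →₀ MvPolynomial V k)}
    {d : (μ →₀ MvPolynomial V k) →ₗ[MvPolynomial V k] (κ →₀ MvPolynomial V k)}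
    (hφ : IsHomogeneousMap p q φ) (hd : IsHomogeneousMap r q d)
    (h : ∀ x, φ x ∈ Set.range d) :
    ∃ ψ : (ι →₀ MvPolynomial V k) →ₗ[MvPolynomial V k] (μ →₀ MvPolynomial V k),
      IsHomogeneousMap p r ψ ∧ ∀ x, d (ψ x) = φ x := by
  choose y hy using fun b => h (Finsupp.single b 1)
  -- the component of degree `p b` of any preimage of `φ e_b` is again a preimage
  let ψ := Finsupp.linearCombination (MvPolynomial V k) fun b => gradedPart r (p b) (y b)
  have hψ (b : ι) : ψ (Finsupp.single b 1) = gradedPart r (p b) (y b) := by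
    simp [ψ]
  refine ⟨ψ, fun b => ?_, fun x => ?_⟩
  · rw [hψ]
    exact isHomogeneousElement_gradedPart r (p b) (y b)
  · have : d ∘ₗ ψ = φ := by
      refine Finsupp.lhom_ext' fun b => LinearMap.ext_ring ?_
      simp only [LinearMap.comp_apply, Finsupp.lsingle_apply]
      rw [hψ, hd.map_gradedPart, hy, (hφ b).gradedPart_eq, if_pos rfl]
    exact LinearMap.congr_fun this x

end Graded

/-! ### Comparison of graded free resolutions -/

section Comparison

universe w'

/-- Dependent choice along the natural numbers, for a sequence of types. -/
lemma exists_seq_of_forall_exists {α : ℕ → Type*} (Q : ∀ i, α i → Prop)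
    (P : ∀ i, α i → α (i + 1) → Prop) (a₀ : α 0) (h₀ : Q 0 a₀)
    (hs : ∀ i a, Q i a → ∃ b, Q (i + 1) b ∧ P i a b) :
    ∃ f : ∀ i, α i, f 0 = a₀ ∧ ∀ i, Q i (f i) ∧ P i (f i) (f (i + 1)) := by
  choose g hg hg' using hs
  let f : ∀ i, {a : α i // Q i a} := fun i =>
    Nat.rec ⟨a₀, h₀⟩ (fun i a => ⟨g i a.1 a.2, hg i a.1 a.2⟩) i
  exact ⟨fun i => (f i).1, rfl, fun i => ⟨(f i).2, hg' i _ _⟩⟩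

namespace FreeSequence

variable {k : Type u} [Field k] {V : Type v} {F : FreeSequence.{u, v, w} k V}
  {G : FreeSequence.{u, v, w'} k V} {I : Ideal (MvPolynomial V k)}
  {εF : (F.ι 0 →₀ MvPolynomial V k) →ₗ[MvPolynomial V k] (MvPolynomial V k ⧸ I)}
  {εG : (G.ι 0 →₀ MvPolynomial V k) →ₗ[MvPolynomial V k] (MvPolynomial V k ⧸ I)}

lemma IsGradedResolution.isHomogeneousMap_d (hF : F.IsGradedResolution I εF) (i : ℕ) :
    IsHomogeneousMap (F.deg (i + 1)) (F.deg i) (F.d i) :=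
  fun b c m hm => hF.d_homogeneous i b c m hm

/-- A homogeneous chain map between two graded free resolutions of `R/I`, over the identity. -/
structure IsComparison
    (εF : (F.ι 0 →₀ MvPolynomial V k) →ₗ[MvPolynomial V k] (MvPolynomial V k ⧸ I))
    (εG : (G.ι 0 →₀ MvPolynomial V k) →ₗ[MvPolynomial V k] (MvPolynomial V k ⧸ I))
    (f : ∀ i, (F.ι i →₀ MvPolynomial V k) →ₗ[MvPolynomial V k] (G.ι i →₀ MvPolynomial V k)) :
    Prop where
  homogeneous : ∀ i, IsHomogeneousMap (F.deg i) (G.deg i) (f i)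
  comm : ∀ i x, G.d i (f (i + 1) x) = f i (F.d i x)
  augmentation : ∀ x, εG (f 0 x) = εF x

/-- A homogeneous map in homological degree zero extends to a comparison map. -/
lemma exists_isComparison (hF : F.IsGradedResolution I εF) (hG : G.IsGradedResolution I εG)
    (f₀ : (F.ι 0 →₀ MvPolynomial V k) →ₗ[MvPolynomial V k] (G.ι 0 →₀ MvPolynomial V k))
    (h₀ : IsHomogeneousMap (F.deg 0) (G.deg 0) f₀) (hε : ∀ x, εG (f₀ x) = εF x) :
    ∃ f : ∀ i, (F.ι i →₀ MvPolynomial V k) →ₗ[MvPolynomial V k] (G.ι i →₀ MvPolynomial V k),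
      IsComparison εF εG f := by
  obtain ⟨f, hf₀, hf⟩ := exists_seq_of_forall_exists
    (α := fun i => (F.ι i →₀ MvPolynomial V k) →ₗ[MvPolynomial V k] (G.ι i →₀ MvPolynomial V k))
    (fun i f => IsHomogeneousMap (F.deg i) (G.deg i) f ∧ ∀ x, f (F.d i x) ∈ Set.range (G.d i))
    (fun i f f' => ∀ x, G.d i (f' x) = f (F.d i x)) f₀
    ⟨h₀, fun x => (hG.exact_augmentation _).1
      (by rw [hε, hF.exact_augmentation.apply_apply_eq_zero])⟩
    (by
      -- the invariant passes on: `f'` maps boundaries to cycles, which are boundaries by exactness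
      rintro i f ⟨hf, hr⟩
      obtain ⟨f', hf', hc⟩ := (hf.comp (hF.isHomogeneousMap_d i)).exists_lift
        (hG.isHomogeneousMap_d i) hr
      refine ⟨f', ⟨hf', fun x => (hG.exact_d i _).1 ?_⟩, hc⟩
      rw [hc, LinearMap.comp_apply, (hF.exact_d i).apply_apply_eq_zero, map_zero])
  exact ⟨f, fun i => (hf i).1.1, fun i => (hf i).2, by rw [hf₀]; exact hε⟩

/-- If there is a comparison map from `F` to `G`, then there is also one from `G` to `F`. -/
lemma IsComparison.exists_reverse (hF : F.IsGradedResolution I εF)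
    (hG : G.IsGradedResolution I εG)
    {f : ∀ i, (F.ι i →₀ MvPolynomial V k) →ₗ[MvPolynomial V k] (G.ι i →₀ MvPolynomial V k)}
    (hf : IsComparison εF εG f) :
    ∃ g : ∀ i, (G.ι i →₀ MvPolynomial V k) →ₗ[MvPolynomial V k] (F.ι i →₀ MvPolynomial V k),
      IsComparison εG εF g := by
  -- the kernel of an augmentation is a graded submodule, being the range of a homogeneous map
  have hker (j : ℤ) (x : G.ι 0 →₀ MvPolynomial V k) (hx : εG x = 0) :
      εG (gradedPart (G.deg 0) j x) = 0 := by
    obtain ⟨y, rfl⟩ := (hG.exact_augmentation x).1 hx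
    rw [← (hG.isHomogeneousMap_d 0).map_gradedPart, hG.exact_augmentation.apply_apply_eq_zero]
  choose y hy using fun b => hF.surjective_augmentation (εG (Finsupp.single b 1))
  let g₀ := Finsupp.linearCombination (MvPolynomial V k)
    fun b => gradedPart (F.deg 0) (G.deg 0 b) (y b)
  have hg₀ (b : G.ι 0) : g₀ (Finsupp.single b 1) = gradedPart (F.deg 0) (G.deg 0 b) (y b) := by
    simp [g₀]
  refine exists_isComparison hG hF g₀ (fun b => ?_) (fun x => ?_)
  · rw [hg₀]
    exact isHomogeneousElement_gradedPart _ _ _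
  · have : εF ∘ₗ g₀ = εG := by
      refine Finsupp.lhom_ext' fun b => LinearMap.ext_ring ?_
      simp only [LinearMap.comp_apply, Finsupp.lsingle_apply]
      have h := hker (G.deg 0 b) (f 0 (y b) - Finsupp.single b 1)
        (by rw [map_sub, hf.augmentation, hy, sub_self])
      rw [map_sub, map_sub, ← (hf.homogeneous 0).map_gradedPart, hf.augmentation,
        (isHomogeneousElement_single (G.deg 0) b).gradedPart_eq, if_pos rfl, sub_eq_zero] at h
      rw [hg₀, h]
    exact LinearMap.congr_fun this x

lemma IsComparison.id (εF : (F.ι 0 →₀ MvPolynomial V k) →ₗ[MvPolynomial V k]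
    (MvPolynomial V k ⧸ I)) : IsComparison εF εF fun _ => LinearMap.id :=
  ⟨fun i => isHomogeneousMap_id (F.deg i), fun _ _ => rfl, fun _ => rfl⟩

lemma IsComparison.comp
    {f : ∀ i, (F.ι i →₀ MvPolynomial V k) →ₗ[MvPolynomial V k] (G.ι i →₀ MvPolynomial V k)}
    {g : ∀ i, (G.ι i →₀ MvPolynomial V k) →ₗ[MvPolynomial V k] (F.ι i →₀ MvPolynomial V k)}
    (hg : IsComparison εG εF g) (hf : IsComparison εF εG f) :
    IsComparison εF εF fun i => g i ∘ₗ f i :=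
  ⟨fun i => (hg.homogeneous i).comp (hf.homogeneous i),
    fun i x => by simp only [LinearMap.comp_apply, hg.comm, hf.comm],
    fun x => by simp only [LinearMap.comp_apply, hg.augmentation, hf.augmentation]⟩

/-- Two comparison maps are homotopic, by a homogeneous homotopy. -/
lemma IsComparison.exists_homotopy (hF : F.IsGradedResolution I εF)
    (hG : G.IsGradedResolution I εG)
    {f g : ∀ i, (F.ι i →₀ MvPolynomial V k) →ₗ[MvPolynomial V k] (G.ι i →₀ MvPolynomial V k)}
    (hf : IsComparison εF εG f) (hg : IsComparison εF εG g) :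
    ∃ h : ∀ i, (F.ι i →₀ MvPolynomial V k) →ₗ[MvPolynomial V k]
        (G.ι (i + 1) →₀ MvPolynomial V k),
      (∀ i, IsHomogeneousMap (F.deg i) (G.deg (i + 1)) (h i)) ∧
      (∀ x, f 0 x - g 0 x = G.d 0 (h 0 x)) ∧
      ∀ i x, f (i + 1) x - g (i + 1) x = G.d (i + 1) (h (i + 1) x) + h i (F.d i x) := by
  obtain ⟨h₀, hh₀, hd₀⟩ := ((hf.homogeneous 0).sub (hg.homogeneous 0)).exists_lift
    (hG.isHomogeneousMap_d 0) (fun x => (hG.exact_augmentation _).1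
      (by rw [LinearMap.sub_apply, map_sub, hf.augmentation, hg.augmentation, sub_self]))
  obtain ⟨h, h_zero, hh⟩ := exists_seq_of_forall_exists
    (α := fun i => (F.ι i →₀ MvPolynomial V k) →ₗ[MvPolynomial V k]
      (G.ι (i + 1) →₀ MvPolynomial V k))
    (fun i h => IsHomogeneousMap (F.deg i) (G.deg (i + 1)) h ∧
      ∀ x, G.d i (h (F.d i x)) = f i (F.d i x) - g i (F.d i x))
    (fun i h h' => ∀ x, G.d (i + 1) (h' x) = (f (i + 1) - g (i + 1) - h ∘ₗ F.d i) x) h₀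
    ⟨hh₀, fun x => hd₀ _⟩
    (by
      rintro i h ⟨hh, hc⟩
      obtain ⟨h', hh', hc'⟩ := (((hf.homogeneous (i + 1)).sub (hg.homogeneous (i + 1))).sub
        (hh.comp (hF.isHomogeneousMap_d i))).exists_lift (hG.isHomogeneousMap_d (i + 1))
        (fun x => (hG.exact_d i _).1 (by
          simp only [LinearMap.sub_apply, LinearMap.comp_apply, map_sub, hf.comm, hg.comm, hc,
            sub_self]))
      refine ⟨h', ⟨hh', fun x => ?_⟩, hc'⟩
      rw [hc', LinearMap.sub_apply, LinearMap.comp_apply, (hF.exact_d i).apply_apply_eq_zero,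
        map_zero, sub_zero, LinearMap.sub_apply])
  refine ⟨h, fun i => (hh i).1.1, fun x => ?_, fun i x => ?_⟩
  · rw [h_zero, hd₀, LinearMap.sub_apply]
  · rw [(hh i).2]
    simp

end FreeSequence

end Comparison

/-! ### Tensoring with the residue field -/

section ResidueField

variable (k : Type u) [Field k] (V : Type v)

lemma mem_maxIdeal_iff (f : MvPolynomial V k) :
    f ∈ maxIdeal k V ↔ MvPolynomial.constantCoeff f = 0 := by
  rw [maxIdeal, ← Set.image_univ, MvPolynomial.mem_ideal_span_X_image,
    MvPolynomial.constantCoeff_eq]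
  constructor
  · intro h
    by_contra h0
    obtain ⟨i, -, hi⟩ := h 0 (MvPolynomial.mem_support_iff.2 h0)
    exact hi rfl
  · intro h m hm
    have hm0 : m ≠ 0 := by
      rintro rfl
      exact MvPolynomial.mem_support_iff.1 hm h
    obtain ⟨i, hi⟩ := Finsupp.ne_iff.1 hm0
    exact ⟨i, trivial, hi⟩

/-- The residue field at the homogeneous maximal ideal is the base field, by taking the constant
coefficient. -/
noncomputable def residueFieldEquiv : ResidueField k V ≃ₐ[k] k :=
  (Ideal.quotientEquivAlgOfEq k (Ideal.ext fun f => (mem_maxIdeal_iff k V f).trans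
    (by simp [RingHom.mem_ker]))).trans
  (Ideal.quotientKerAlgEquivOfSurjective
    (f := (MvPolynomial.aeval (fun _ : V => (0 : k)))) fun c => ⟨MvPolynomial.C c, by simp⟩)

open Classical in
/-- The basis of `(⊕ R e_b) ⊗ k` that consists of the elements `e_b ⊗ 1`. -/
noncomputable def tensorBasis (ι : Type w) :
    Module.Basis ι k ((ι →₀ MvPolynomial V k) ⊗[MvPolynomial V k] ResidueField k V) :=
  .ofRepr (((TensorProduct.finsuppScalarLeft (MvPolynomial V k) (ResidueField k V) ι).restrictScalars
    k) ≪≫ₗ Finsupp.mapRange.linearEquiv (residueFieldEquiv k V).toLinearEquiv)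

lemma tensorBasis_apply {ι : Type w} (b : ι) :
    tensorBasis k V ι b = Finsupp.single b 1 ⊗ₜ[MvPolynomial V k] 1 := by
  classical
  rw [tensorBasis, Module.Basis.coe_ofRepr, LinearEquiv.symm_apply_eq]
  ext c
  simp [Finsupp.single_apply]

variable {k V}

lemma smul_residueField_one (f : MvPolynomial V k) :
    f • (1 : ResidueField k V) = MvPolynomial.constantCoeff f • (1 : ResidueField k V) := by
  change Ideal.Quotient.mk _ (f * 1) =
    Ideal.Quotient.mk _ (MvPolynomial.constantCoeff f • (1 : MvPolynomial V k))
  refine Ideal.Quotient.eq.2 ((mem_maxIdeal_iff k V _).2 ?_)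
  simp [MvPolynomial.smul_eq_C_mul]

end ResidueField

namespace FreeSequence

universe w'

variable {k : Type u} [Field k] {V : Type v} {F : FreeSequence.{u, v, w} k V}
  {G : FreeSequence.{u, v, w'} k V}

/-- The map `φ ⊗ k` on the terms of two sequences. -/
noncomputable def tensorMap {i i' : ℕ}
    (φ : (F.ι i →₀ MvPolynomial V k) →ₗ[MvPolynomial V k] (G.ι i' →₀ MvPolynomial V k)) :
    F.tensor i →ₗ[k] G.tensor i' :=
  (φ.rTensor (ResidueField k V)).restrictScalars k

/-- Homogeneous maps of degree zero preserve degrees after tensoring with the field, since only the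
constant coefficients survive. -/
lemma tensorMap_mem_tensorPiece {i i' : ℕ}
    {φ : (F.ι i →₀ MvPolynomial V k) →ₗ[MvPolynomial V k] (G.ι i' →₀ MvPolynomial V k)}
    (hφ : IsHomogeneousMap (F.deg i) (G.deg i') φ) {j : ℤ} {x : F.tensor i}
    (hx : x ∈ F.tensorPiece i j) : tensorMap φ x ∈ G.tensorPiece i' j := by
  have hle : F.tensorPiece i j ≤ (G.tensorPiece i' j).comap (tensorMap φ) := by
    refine Submodule.span_le.2 ?_
    rintro _ ⟨b, hb, rfl⟩
    change (φ (Finsupp.single b 1) ⊗ₜ[MvPolynomial V k] 1 : (G.ι i' →₀ MvPolynomial V k)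
      ⊗[MvPolynomial V k] ResidueField k V) ∈ G.tensorPiece i' j
    rw [← Finsupp.sum_single (φ (Finsupp.single b 1)), Finsupp.sum, TensorProduct.sum_tmul]
    refine Submodule.sum_mem _ fun c _ => ?_
    rw [← mul_one (φ (Finsupp.single b 1) c), ← smul_eq_mul, ← Finsupp.smul_single,
      TensorProduct.smul_tmul, smul_residueField_one, TensorProduct.tmul_smul]
    by_cases h0 : MvPolynomial.constantCoeff (φ (Finsupp.single b 1) c) = 0
    · rw [h0, zero_smul]
      exact Submodule.zero_mem _
    · refine (G.tensorPiece i' j).smul_mem _ (Submodule.subset_span ⟨c, ?_, rfl⟩)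
      have := hφ b c 0 (MvPolynomial.mem_support_iff.2
        (by rwa [MvPolynomial.constantCoeff_eq] at h0))
      rw [← hb, ← this]
      simp
  exact hle hx

/-- The differentials of a minimal sequence vanish after tensoring with the field. -/
lemma IsMinimal.rTensor_d (hF : F.IsMinimal) (i : ℕ) :
    (F.d i).rTensor (ResidueField k V) = 0 := by
  refine TensorProduct.ext' fun x y => ?_
  rw [LinearMap.rTensor_tmul, LinearMap.zero_apply]
  have h := hF i (LinearMap.mem_range_self (F.d i) x)
  generalize F.d i x = z at h
  induction h using Submodule.smul_induction_on' with
  | smul r hr z _ =>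
    obtain ⟨y, rfl⟩ := Ideal.Quotient.mk_surjective y
    rw [TensorProduct.smul_tmul]
    have : r • (Ideal.Quotient.mk (maxIdeal k V) y) = 0 := by
      change Ideal.Quotient.mk (maxIdeal k V) (r * y) = 0
      exact Ideal.Quotient.eq_zero_iff_mem.2 (Ideal.mul_mem_right _ _ hr)
    rw [this, TensorProduct.tmul_zero]
  | add a _ b _ ha hb => rw [TensorProduct.add_tmul, ha, hb, add_zero]

lemma IsMinimal.tensorD_apply (hF : F.IsMinimal) (i : ℕ) (x : F.tensor (i + 1)) :
    F.tensorD i x = 0 :=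
  LinearMap.congr_fun (hF.rTensor_d i) x

/-- The degree `j` part of `F_i ⊗ k` has the basis elements of degree `j` as a basis. -/
lemma rank_tensorPiece (F : FreeSequence.{u, v, w} k V) (i : ℕ) (j : ℤ) :
    Module.rank k (F.tensorPiece i j) =
      Cardinal.lift.{max u v} (Cardinal.mk {b : F.ι i // F.deg i b = j}) := by
  let B := tensorBasis k V (F.ι i)
  have hli : LinearIndependent k fun b : {b : F.ι i // F.deg i b = j} => B b.1 :=
    B.linearIndependent.comp _ Subtype.val_injective
  have hspan : F.tensorPiece i j =
      Submodule.span k (Set.range fun b : {b : F.ι i // F.deg i b = j} => B b.1) := by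
    refine congrArg (Submodule.span k) (Set.ext fun t => ?_)
    constructor
    · rintro ⟨b, hb, rfl⟩
      exact ⟨⟨b, hb⟩, tensorBasis_apply k V b⟩
    · rintro ⟨b, rfl⟩
      exact ⟨b.1, b.2, tensorBasis_apply k V b.1⟩
  rw [hspan]
  refine (rank_span hli).trans ?_
  have := Cardinal.mk_range_eq_of_injective hli.injective
  rwa [Cardinal.lift_id'.{w, max u v}, Cardinal.lift_umax.{w, max u v}] at this

variable {I : Ideal (MvPolynomial V k)}
  {εF : (F.ι 0 →₀ MvPolynomial V k) →ₗ[MvPolynomial V k] (MvPolynomial V k ⧸ I)}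
  {εG : (G.ι 0 →₀ MvPolynomial V k) →ₗ[MvPolynomial V k] (MvPolynomial V k ⧸ I)}

lemma tensorMap_comp_apply {H : FreeSequence.{u, v, w} k V} {i i' i'' : ℕ}
    (ψ : (G.ι i' →₀ MvPolynomial V k) →ₗ[MvPolynomial V k] (H.ι i'' →₀ MvPolynomial V k))
    (φ : (F.ι i →₀ MvPolynomial V k) →ₗ[MvPolynomial V k] (G.ι i' →₀ MvPolynomial V k))
    (x : F.tensor i) : tensorMap (ψ ∘ₗ φ) x = tensorMap ψ (tensorMap φ x) :=
  LinearMap.rTensor_comp_apply (ResidueField k V) ψ φ x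

lemma IsComparison.tensorD_tensorMap
    {f : ∀ i, (F.ι i →₀ MvPolynomial V k) →ₗ[MvPolynomial V k] (G.ι i →₀ MvPolynomial V k)}
    (hf : IsComparison εF εG f) (i : ℕ) (x : F.tensor (i + 1)) :
    G.tensorD i (tensorMap (f (i + 1)) x) = tensorMap (f i) (F.tensorD i x) := by
  have h : G.d i ∘ₗ f (i + 1) = f i ∘ₗ F.d i := LinearMap.ext (hf.comm i)
  have h' := congrArg (LinearMap.rTensor (ResidueField k V)) h
  rw [LinearMap.rTensor_comp, LinearMap.rTensor_comp] at h'
  exact LinearMap.congr_fun h' x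

lemma IsComparison.tensorMap_mem_cycles
    {f : ∀ i, (F.ι i →₀ MvPolynomial V k) →ₗ[MvPolynomial V k] (G.ι i →₀ MvPolynomial V k)}
    (hf : IsComparison εF εG f) {i : ℕ} {x : F.tensor i} (hx : x ∈ F.cycles i) :
    tensorMap (f i) x ∈ G.cycles i := by
  cases i with
  | zero => exact Submodule.mem_top
  | succ i =>
    change G.tensorD i _ = 0
    rw [hf.tensorD_tensorMap, show F.tensorD i x = 0 from hx, map_zero]

/-- Two comparison maps agree on cycles of `F ⊗ k` up to boundaries. -/
lemma IsComparison.exists_tensorMap_sub_eq (hF : F.IsGradedResolution I εF)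
    (hG : G.IsGradedResolution I εG)
    {f g : ∀ i, (F.ι i →₀ MvPolynomial V k) →ₗ[MvPolynomial V k] (G.ι i →₀ MvPolynomial V k)}
    (hf : IsComparison εF εG f) (hg : IsComparison εF εG g) {i : ℕ} {j : ℤ} {x : F.tensor i}
    (hx : x ∈ F.cycles i ⊓ F.tensorPiece i j) :
    ∃ y ∈ G.tensorPiece (i + 1) j,
      tensorMap (f i) x - tensorMap (g i) x = G.tensorD i y := by
  obtain ⟨h, hh, h_zero, h_succ⟩ := hf.exists_homotopy hF hG hg
  refine ⟨tensorMap (h i) x, tensorMap_mem_tensorPiece (hh i) hx.2, ?_⟩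
  cases i with
  | zero =>
    have e : f 0 - g 0 = G.d 0 ∘ₗ h 0 := LinearMap.ext h_zero
    have e' := congrArg (LinearMap.rTensor (ResidueField k V)) e
    rw [LinearMap.rTensor_sub, LinearMap.rTensor_comp] at e'
    exact LinearMap.congr_fun e' x
  | succ i =>
    have e : f (i + 1) - g (i + 1) = G.d (i + 1) ∘ₗ h (i + 1) + h i ∘ₗ F.d i :=
      LinearMap.ext (h_succ i)
    have e' := congrArg (LinearMap.rTensor (ResidueField k V)) e
    rw [LinearMap.rTensor_sub, LinearMap.rTensor_add, LinearMap.rTensor_comp,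
      LinearMap.rTensor_comp] at e'
    have e'' : tensorMap (f (i + 1)) x - tensorMap (g (i + 1)) x =
        G.tensorD (i + 1) (tensorMap (h (i + 1)) x) + tensorMap (h i) (F.tensorD i x) :=
      LinearMap.congr_fun e' x
    rw [e'', show F.tensorD i x = 0 from hx.1, map_zero, add_zero]

/-- The graded pieces of `Tor` that `F` computes are the graded pieces of `G ⊗ k`, for a minimal
graded free resolution `G`. -/
theorem IsComparison.nonempty_torPiece_equiv (hF : F.IsGradedResolution I εF)
    (hG : G.IsGradedResolution I εG) (hmin : G.IsMinimal)
    {f : ∀ i, (F.ι i →₀ MvPolynomial V k) →ₗ[MvPolynomial V k] (G.ι i →₀ MvPolynomial V k)}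
    (hf : IsComparison εF εG f) (i : ℕ) (j : ℤ) :
    Nonempty (F.torPiece i j ≃ₗ[k] G.tensorPiece i j) := by
  obtain ⟨g, hg⟩ := hf.exists_reverse hF hG
  let φ : ↥(F.cycles i ⊓ F.tensorPiece i j) →ₗ[k] G.tensorPiece i j :=
    (tensorMap (f i)).restrict fun x hx => tensorMap_mem_tensorPiece (hf.homogeneous i) hx.2
  have hφ : ((F.tensorPiece (i + 1) j).map (F.tensorD i)).submoduleOf
      (F.cycles i ⊓ F.tensorPiece i j) ≤ LinearMap.ker φ := by
    rintro x ⟨y, -, hy⟩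
    refine LinearMap.mem_ker.2 (Subtype.ext ?_)
    change tensorMap (f i) x.1 = 0
    rw [show x.1 = F.tensorD i y from hy.symm, ← hf.tensorD_tensorMap, hmin.tensorD_apply]
  refine ⟨LinearEquiv.ofBijective (Submodule.liftQ _ φ hφ) ⟨?_, ?_⟩⟩
  · rw [← LinearMap.ker_eq_bot, Submodule.ker_liftQ_eq_bot']
    refine le_antisymm hφ fun x hx => ?_
    obtain ⟨y, hy, hxy⟩ :=
      (IsComparison.id εF).exists_tensorMap_sub_eq hF hF (hg.comp hf) x.2
    refine ⟨y, hy, hxy.symm.trans ?_⟩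
    have h0 : tensorMap (f i) x.1 = 0 := congrArg Subtype.val (LinearMap.mem_ker.1 hx)
    rw [tensorMap_comp_apply, h0, map_zero, sub_zero]
    exact LinearMap.congr_fun (LinearMap.rTensor_id _ _) x.1
  · intro y
    have hy : y.1 ∈ G.cycles i := by
      cases i with
      | zero => exact Submodule.mem_top
      | succ i => exact hmin.tensorD_apply i y.1
    refine ⟨Submodule.Quotient.mk ⟨tensorMap (g i) y.1, hg.tensorMap_mem_cycles hy,
      tensorMap_mem_tensorPiece (hg.homogeneous i) y.2⟩, Subtype.ext ?_⟩
    obtain ⟨z, -, hz⟩ := (IsComparison.id εG).exists_tensorMap_sub_eq hG hG (hf.comp hg)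
      ⟨hy, y.2⟩
    rw [hmin.tensorD_apply, tensorMap_comp_apply, sub_eq_zero] at hz
    refine hz.symm.trans ?_
    exact LinearMap.congr_fun (LinearMap.rTensor_id _ _) y.1

end FreeSequence

/-! ### Squarefree monomials and free vertices -/

section Squarefree

variable {V : Type v}

lemma squarefreeExponent_apply [DecidableEq V] (F : Finset V) (x : V) :
    squarefreeExponent F x = if x ∈ F then 1 else 0 := by
  simp [squarefreeExponent, Finsupp.finsetSum_apply, Finsupp.single_apply]

lemma degree_squarefreeExponent (F : Finset V) : (squarefreeExponent F).degree = F.card := by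
  simp [squarefreeExponent]

lemma lcmExponent_squarefreeExponent [DecidableEq V] {n : ℕ} (E : Fin n → Finset V)
    (S : Finset (Fin n)) :
    lcmExponent (fun t => squarefreeExponent (E t)) S = squarefreeExponent (S.biUnion E) := by
  induction S using Finset.induction_on with
  | empty => simp [lcmExponent, squarefreeExponent, bot_eq_zero]
  | insert t S _ ih =>
    rw [lcmExponent] at ih ⊢
    rw [Finset.sup_insert, ih, Finset.biUnion_insert]
    ext x
    rw [Finsupp.sup_apply]
    simp only [squarefreeExponent_apply, Finset.mem_union]
    by_cases h₁ : x ∈ E t <;> by_cases h₂ : x ∈ S.biUnion E <;> simp only [h₁, h₂] <;> rfl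

lemma squarefreeMonomial_eq_monomial (k : Type u) [Field k] (F : Finset V) :
    squarefreeMonomial k F = MvPolynomial.monomial (squarefreeExponent F) 1 := by
  rw [squarefreeMonomial, squarefreeExponent, MvPolynomial.monomial_sum_one]
  rfl

lemma edgeIdeal_eq_span (k : Type u) [Field k] (H : Hypergraph V) {n : ℕ} (E : Fin n → Finset V)
    (hE : H.edgeSet = Set.range fun t => (E t : Set V)) :
    edgeIdeal k H =
      Ideal.span (Set.range fun t => MvPolynomial.monomial (squarefreeExponent (E t)) (1 : k)) := by
  classical
  refine le_antisymm (Ideal.span_le.2 ?_) (Ideal.span_le.2 ?_)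
  · rintro _ ⟨F, hF, rfl⟩
    obtain ⟨t, ht⟩ : ∃ t, E t ⊆ F := by
      simpa [independenceComplex, hE] using hF
    rw [SetLike.mem_coe, squarefreeMonomial, ← Finset.prod_sdiff ht]
    refine Ideal.mul_mem_left _ _ (Ideal.subset_span ⟨t, ?_⟩)
    exact (squarefreeMonomial_eq_monomial k (E t)).symm
  · rintro _ ⟨t, rfl⟩
    refine Ideal.subset_span ⟨E t, ?_, (squarefreeMonomial_eq_monomial k (E t)).symm⟩
    simp only [independenceComplex, hE, Set.mem_ofPred_eq, not_forall, not_not]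
    exact ⟨_, ⟨t, rfl⟩, subset_rfl⟩

/-- A free vertex of an edge lies in no other edge of the family. -/
lemma exists_mem_only {H : Hypergraph V} {n : ℕ} {E : Fin n → Finset V}
    (hinj : Function.Injective E) (hE : H.edgeSet = Set.range fun t => (E t : Set V))
    (hfree : ∀ t : Fin n, ∃ x ∈ E t, IsFreeVertex H x) (t : Fin n) :
    ∃ x ∈ E t, ∀ s, x ∈ E s → s = t := by
  obtain ⟨x, hx, -, hsub⟩ := hfree t
  refine ⟨x, hx, fun s hs => hinj (Finset.coe_injective (hsub ⟨?_, hs⟩ ⟨?_, hx⟩))⟩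
  · exact hE ▸ ⟨s, rfl⟩
  · exact hE ▸ ⟨t, rfl⟩

lemma biUnion_injective_of_exists_mem_only [DecidableEq V] {n : ℕ} {E : Fin n → Finset V}
    (h : ∀ t, ∃ x ∈ E t, ∀ s, x ∈ E s → s = t) :
    Function.Injective fun S : Finset (Fin n) => S.biUnion E := by
  have hmem (S : Finset (Fin n)) (t : Fin n) (x : V) (hx : x ∈ E t)
      (ho : ∀ s, x ∈ E s → s = t) : t ∈ S ↔ x ∈ S.biUnion E := by
    rw [Finset.mem_biUnion]
    exact ⟨fun ht => ⟨t, ht, hx⟩, fun ⟨s, hs, hxs⟩ => ho s hxs ▸ hs⟩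
  intro S T hST
  ext t
  obtain ⟨x, hx, ho⟩ := h t
  rw [hmem S t x hx ho, hmem T t x hx ho]
  exact Finset.ext_iff.1 hST x

end Squarefree

/-! ### Minimality and graded Betti numbers -/

section Minimality

variable {k : Type u} [Field k] {V : Type v} {n : ℕ}

/-- A sequence is minimal if the matrix entries of its differentials lie in the maximal ideal. -/
lemma FreeSequence.isMinimal_of_mem_maxIdeal {F : FreeSequence.{u, v, w} k V}
    (h : ∀ i b c, F.d i (Finsupp.single b 1) c ∈ maxIdeal k V) : F.IsMinimal := by
  rintro i _ ⟨x, rfl⟩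
  induction x using Finsupp.induction_linear with
  | zero =>
    rw [map_zero]
    exact Submodule.zero_mem _
  | add f g hf hg =>
    rw [map_add]
    exact Submodule.add_mem _ hf hg
  | single b f =>
    rw [← mul_one f, ← smul_eq_mul, ← Finsupp.smul_single, map_smul]
    refine Submodule.smul_mem _ _ ?_
    rw [← Finsupp.sum_single (F.d i (Finsupp.single b 1)), Finsupp.sum]
    refine Submodule.sum_mem _ fun c _ => ?_
    rw [← mul_one (F.d i (Finsupp.single b 1) c), ← smul_eq_mul, ← Finsupp.smul_single]
    exact Submodule.smul_mem_smul (h i b c) trivial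

/-- The Taylor complex is minimal if every omission of an index makes the least common multiple
smaller. -/
lemma taylor_isMinimal {a : Fin n → V →₀ ℕ}
    (h : ∀ S : Finset (Fin n), ∀ s ∈ S, lcmExponent a (S.erase s) ≠ lcmExponent a S) :
    (taylor k a).IsMinimal := by
  refine FreeSequence.isMinimal_of_mem_maxIdeal fun i S T => ?_
  rw [mem_maxIdeal_iff, MvPolynomial.constantCoeff_eq]
  by_contra h0
  obtain ⟨s, hs, -, hm⟩ :=
    exists_of_mem_support_taylorD k a S T (MvPolynomial.mem_support_iff.2 h0)
  exact h S.1 s hs ((lcmExponent_mono a (Finset.erase_subset _ _)).antisymm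
    (tsub_eq_zero_iff_le.1 hm.symm))

lemma taylor_isMinimal_of_exists_mem_only {E : Fin n → Finset V}
    (h : ∀ t, ∃ x ∈ E t, ∀ s, x ∈ E s → s = t) :
    (taylor k fun t => squarefreeExponent (E t)).IsMinimal := by
  classical
  refine taylor_isMinimal fun S s hs heq => ?_
  obtain ⟨x, hx, ho⟩ := h s
  rw [lcmExponent_squarefreeExponent, lcmExponent_squarefreeExponent] at heq
  have hx' := DFunLike.congr_fun heq x
  rw [squarefreeExponent_apply, squarefreeExponent_apply,
    if_pos (Finset.mem_biUnion.2 ⟨s, hs, hx⟩), if_neg] at hx'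
  · exact zero_ne_one hx'
  · intro hmem
    obtain ⟨t, ht, hxt⟩ := Finset.mem_biUnion.1 hmem
    exact (Finset.mem_erase.1 ht).1 (ho t hxt)

end Minimality

namespace FreeSequence

variable {k : Type u} [Field k] {V : Type v} {n : ℕ}

/-- The augmentation of a graded free resolution of `R/I` lifts to the Taylor complex, as the Taylor
complex has `R` in homological degree zero. -/
lemma IsGradedResolution.exists_isComparison_taylor {F : FreeSequence.{u, v, w} k V}
    {I : Ideal (MvPolynomial V k)}
    {ε : (F.ι 0 →₀ MvPolynomial V k) →ₗ[MvPolynomial V k] (MvPolynomial V k ⧸ I)}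
    (hF : F.IsGradedResolution I ε) {a : Fin n → V →₀ ℕ}
    (hT : (taylor k a).IsGradedResolution I (taylorAugmentation a I)) :
    ∃ f : ∀ i, (F.ι i →₀ MvPolynomial V k) →ₗ[MvPolynomial V k]
      ((taylor k a).ι i →₀ MvPolynomial V k), IsComparison ε (taylorAugmentation a I) f := by
  choose p hp hdeg using hF.augmentation_homogeneous
  let e : (taylor k a).ι 0 := (⟨∅, Finset.card_empty⟩ : {S : Finset (Fin n) // S.card = 0})
  let f₀ : (F.ι 0 →₀ MvPolynomial V k) →ₗ[MvPolynomial V k]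
      ((taylor k a).ι 0 →₀ MvPolynomial V k) :=
    Finsupp.linearCombination (MvPolynomial V k) fun b => Finsupp.single e (p b)
  have hf₀ (b : F.ι 0) : f₀ (Finsupp.single b 1) = Finsupp.single e (p b) := by
    simp [f₀]
  have he : (taylor k a).deg 0 e = 0 := by
    change ((lcmExponent a ∅).degree : ℤ) = 0
    simp [lcmExponent, bot_eq_zero]
  refine exists_isComparison hF hT f₀ (fun b c m hm => ?_) (fun x => ?_)
  · obtain rfl : c = e := Subtype.ext (Finset.card_eq_zero.1 c.2)
    rw [hf₀, Finsupp.single_eq_same] at hm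
    rw [he, add_zero]
    exact hdeg b m hm
  · have : taylorAugmentation a I ∘ₗ f₀ = ε := by
      refine Finsupp.lhom_ext' fun b => LinearMap.ext_ring ?_
      simp only [LinearMap.comp_apply, Finsupp.lsingle_apply]
      rw [hf₀, ← hp]
      refine (taylorAugmentation_apply k a I _).trans ?_
      exact congrArg _ Finsupp.single_eq_same
    exact LinearMap.congr_fun this x

/-- A minimal Taylor complex computes the graded Betti numbers of all graded free resolutions. -/
theorem IsGradedResolution.gradedBetti_eq_card {F : FreeSequence.{u, v, w} k V}
    {I : Ideal (MvPolynomial V k)}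
    {ε : (F.ι 0 →₀ MvPolynomial V k) →ₗ[MvPolynomial V k] (MvPolynomial V k ⧸ I)}
    (hF : F.IsGradedResolution I ε) {a : Fin n → V →₀ ℕ}
    (hT : (taylor k a).IsGradedResolution I (taylorAugmentation a I))
    (hmin : (taylor k a).IsMinimal) (i : ℕ) (j : ℤ) :
    F.gradedBetti i j = ((((Finset.univ : Finset (Fin n)).powersetCard i).filter
      fun S => ((lcmExponent a S).degree : ℤ) = j).card : Cardinal) := by
  obtain ⟨f, hf⟩ := hF.exists_isComparison_taylor hT
  obtain ⟨e⟩ := hf.nonempty_torPiece_equiv hF hT hmin i j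
  have hcard : Cardinal.mk {b : (taylor k a).ι i // (taylor k a).deg i b = j} =
      (((Finset.univ : Finset (Fin n)).powersetCard i).filter
        fun S => ((lcmExponent a S).degree : ℤ) = j).card := by
    rw [← Cardinal.mk_coe_finset]
    refine Cardinal.mk_congr ((Equiv.subtypeSubtypeEquivSubtypeInter
      (fun S : Finset (Fin n) => S.card = i) fun S => ((lcmExponent a S).degree : ℤ) = j).trans
      (Equiv.subtypeEquivRight fun S => ?_))
    simp
  have h := e.lift_rank_eq
  rw [rank_tensorPiece, hcard] at h
  rw [gradedBetti]
  simpa using h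

end FreeSequence

/-! ### Tor of modules and total Betti numbers -/

section Tor

universe r

variable {R : Type r} [CommRing R]

/-- An exact sequence `⋯ → X₁ → X₀` of modules as a chain complex. -/
noncomputable def resolutionComplex (X : ℕ → Type r) [∀ i, AddCommGroup (X i)]
    [∀ i, Module R (X i)] (d : ∀ i, X (i + 1) →ₗ[R] X i)
    (hd : ∀ i, Function.Exact (d (i + 1)) (d i)) : ChainComplex (ModuleCat.{r} R) ℕ :=
  ChainComplex.of (fun i => ModuleCat.of R (X i)) (fun i => ModuleCat.ofHom (d i)) fun i => by
    rw [← ModuleCat.ofHom_comp, (hd i).linearMap_comp_eq_zero]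
    rfl

variable (X : ℕ → Type r) [∀ i, AddCommGroup (X i)]
    [∀ i, Module R (X i)] (d : ∀ i, X (i + 1) →ₗ[R] X i)
    (hd : ∀ i, Function.Exact (d (i + 1)) (d i))

lemma resolutionComplex_d (i : ℕ) :
    (resolutionComplex X d hd).d (i + 1) i = ModuleCat.ofHom (d i) :=
  ChainComplex.of_d (fun i => ModuleCat.of R (X i)) (fun i => ModuleCat.ofHom (d i)) i

/-- The augmentation of the complex of an exact sequence `⋯ → X₁ → X₀ → M → 0`. -/
noncomputable def resolutionAugmentation (M : Type r) [AddCommGroup M] [Module R M]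
    (ε : X 0 →ₗ[R] M) (hε : Function.Exact (d 0) ε) :
    resolutionComplex X d hd ⟶ (ChainComplex.single₀ (ModuleCat.{r} R)).obj (ModuleCat.of R M) :=
  (ChainComplex.toSingle₀Equiv _ _).symm ⟨ModuleCat.ofHom ε, by
    rw [resolutionComplex_d]
    refine (ModuleCat.ofHom_comp _ _).symm.trans ?_
    rw [hε.linearMap_comp_eq_zero]
    rfl⟩

lemma resolutionAugmentation_f_zero (M : Type r) [AddCommGroup M] [Module R M]
    (ε : X 0 →ₗ[R] M) (hε : Function.Exact (d 0) ε) :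
    (resolutionAugmentation X d hd M ε hε).f 0 = ModuleCat.ofHom ε :=
  ChainComplex.toSingle₀Equiv_symm_apply_f_zero _ _

lemma quasiIso_resolutionAugmentation (M : Type r) [AddCommGroup M] [Module R M]
    (ε : X 0 →ₗ[R] M) (hε : Function.Exact (d 0) ε) (hs : Function.Surjective ε) :
    QuasiIso (resolutionAugmentation X d hd M ε hε) := by
  refine ⟨fun i => ?_⟩
  cases i with
  | zero =>
    rw [ChainComplex.quasiIsoAt₀_iff, ShortComplex.quasiIso_iff_of_zeros' _ rfl rfl rfl]
    constructor
    · rw [ShortComplex.moduleCat_exact_iff]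
      intro x hx
      have hx' : (resolutionAugmentation X d hd M ε hε).f 0 x = 0 := hx
      rw [resolutionAugmentation_f_zero] at hx'
      obtain ⟨y, hy⟩ := (hε x).1 hx'
      refine ⟨y, ?_⟩
      change (resolutionComplex X d hd).d 1 0 y = x
      rw [resolutionComplex_d]
      exact hy
    · rw [ModuleCat.epi_iff_surjective]
      change Function.Surjective ((resolutionAugmentation X d hd M ε hε).f 0)
      rw [resolutionAugmentation_f_zero]
      exact hs
  | succ i =>
    rw [quasiIsoAt_iff_exactAt' (hL := ChainComplex.exactAt_succ_single_obj ..),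
        HomologicalComplex.exactAt_iff' _ (i + 2) (i + 1) i (by simp) (by simp),
        ShortComplex.moduleCat_exact_iff]
    intro x hx
    have hx' : (resolutionComplex X d hd).d (i + 1) i x = 0 := hx
    rw [resolutionComplex_d] at hx'
    obtain ⟨y, hy⟩ := (hd i x).1 hx'
    refine ⟨y, ?_⟩
    change (resolutionComplex X d hd).d (i + 1 + 1) (i + 1) y = x
    rw [resolutionComplex_d]
    exact hy

/-- An exact sequence `⋯ → X₁ → X₀ → M → 0` of modules with projective `X_i`, as a projective
resolution of `M`. -/
noncomputable def projectiveResolutionOfExact [∀ i, Module.Projective R (X i)]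
    (M : Type r) [AddCommGroup M] [Module R M] (ε : X 0 →ₗ[R] M)
    (hε : Function.Exact (d 0) ε) (hs : Function.Surjective ε) :
    ProjectiveResolution (ModuleCat.of R M) where
  complex := resolutionComplex X d hd
  projective i := inferInstanceAs (Projective (ModuleCat.of R (X i)))
  π := resolutionAugmentation X d hd M ε hε
  quasiIso := quasiIso_resolutionAugmentation X d hd M ε hε hs

/-- The homology of a complex with zero differentials is the complex itself. -/
noncomputable def homologyIsoOfZero {C : Type*} [Category* C] [Abelian C] (K : ChainComplex C ℕ)
    (hK : ∀ i, K.d (i + 1) i = 0) (i : ℕ) : K.homology i ≅ K.X i :=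
  have h (p q : ℕ) : K.d p q = 0 := by
    by_cases hpq : (ComplexShape.down ℕ).Rel p q
    · obtain rfl : q + 1 = p := hpq
      exact hK q
    · exact K.shape p q hpq
  (ShortComplex.HomologyData.ofZeros (K.sc i) (h _ _) (h _ _)).left.homologyIso

/-- `Tor` of a module `M` is computed by a projective resolution whose differentials vanish after
tensoring. -/
noncomputable def torIsoOfExact [∀ i, Module.Projective R (X i)]
    (M : Type r) [AddCommGroup M] [Module R M] (ε : X 0 →ₗ[R] M)
    (hε : Function.Exact (d 0) ε) (hs : Function.Surjective ε)
    (N : Type r) [AddCommGroup N] [Module R N] (hN : ∀ i, (d i).rTensor N = 0) (i : ℕ) :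
    ((Tor' (ModuleCat.{r} R) i).obj (ModuleCat.of R M)).obj (ModuleCat.of R N) ≅
      ModuleCat.of R (X i ⊗[R] N) :=
  ((projectiveResolutionOfExact X d hd M ε hε hs).isoLeftDerivedObj
    ((MonoidalCategory.tensoringRight (ModuleCat.{r} R)).obj (ModuleCat.of R N)) i).trans
  (homologyIsoOfZero _ (fun i => by
    change MonoidalCategory.whiskerRight ((resolutionComplex X d hd).d (i + 1) i) _ = 0
    rw [resolutionComplex_d]
    refine ModuleCat.hom_ext ?_
    exact hN i) i)

end Tor

section Betti

lemma rank_restrictScalars {K : Type*} {R : Type*} [Field K] [CommRing R] [Algebra K R] (M : Type v)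
    [AddCommGroup M] [Module R M] [Module K M] [IsScalarTower K R M] :
    Module.rank K ((ModuleCat.restrictScalars (algebraMap K R)).obj (ModuleCat.of R M)) =
      Module.rank K M :=
  LinearEquiv.rank_eq (M := (ModuleCat.restrictScalars (algebraMap K R)).obj (ModuleCat.of R M))
    { AddEquiv.refl M with
      map_smul' := fun c x => algebraMap_smul R c (show M from x) }

variable {k : Type u} [Field k] {V : Type v}

/-- The Betti numbers of `R/I` are the ranks of the modules of a minimal graded free resolution. -/
theorem FreeSequence.betti_eq_mk {F : FreeSequence.{u, v, 0} k V} {I : Ideal (MvPolynomial V k)}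
    {ε : (F.ι 0 →₀ MvPolynomial V k) →ₗ[MvPolynomial V k] (MvPolynomial V k ⧸ I)}
    (hF : F.IsGradedResolution I ε) (hmin : F.IsMinimal) (i : ℕ) :
    betti I i = Cardinal.lift.{max u v} (Cardinal.mk (F.ι i)) := by
  have e := torIsoOfExact (R := MvPolynomial V k) (fun i => F.ι i →₀ MvPolynomial V k) F.d
    hF.exact_d _ ε hF.exact_augmentation hF.surjective_augmentation (ResidueField k V)
    hmin.rTensor_d i
  have e' := ((ModuleCat.restrictScalars (algebraMap k (MvPolynomial V k))).mapIso
    e).toLinearEquiv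
  rw [betti, e'.rank_eq, rank_restrictScalars]
  have := (tensorBasis k V (F.ι i)).mk_eq_rank
  simpa using this.symm

end Betti

end HypergraphBetti

theorem mainTheorem3 {k : Type u} [Field k] {V : Type v} [Finite V] [DecidableEq V]
    (H : Hypergraph V) (hV : H.vertexSet = Set.univ)
    (n : ℕ) (E : Fin n → Finset V) (hinj : Function.Injective E)
    (hE : H.edgeSet = Set.range fun t => (E t : Set V))
    (hfree : ∀ t : Fin n, ∃ x ∈ E t, IsFreeVertex H x) :
    -- the Taylor complex of the edges is a graded free resolution of `R/I(H)`, and it is minimal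
    ((taylor k fun t => squarefreeExponent (E t)).IsGradedResolution (edgeIdeal k H)
        (taylorAugmentation (fun t => squarefreeExponent (E t)) (edgeIdeal k H)) ∧
      (taylor k fun t => squarefreeExponent (E t)).IsMinimal) ∧
    -- the graded Betti numbers, computed by any graded free resolution of `R/I(H)`: they count the
    -- `i`-subsets of edges with a union of size `j`, and also these unions themselves
    (∀ (F : FreeSequence.{u, v, w} k V)
        (ε : (F.ι 0 →₀ MvPolynomial V k) →ₗ[MvPolynomial V k] (MvPolynomial V k ⧸ edgeIdeal k H)),
        F.IsGradedResolution (edgeIdeal k H) ε → ∀ (i : ℕ) (j : ℤ),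
          F.gradedBetti i j =
              ((((Finset.univ : Finset (Fin n)).powersetCard i).filter
                fun S => ((S.biUnion E).card : ℤ) = j).card : Cardinal) ∧
          F.gradedBetti i j =
              (((((Finset.univ : Finset (Fin n)).powersetCard i).image fun S => S.biUnion E).filter
                fun U => (U.card : ℤ) = j).card : Cardinal)) ∧
    -- the total Betti numbers
    ∀ i : ℕ, betti (edgeIdeal k H) i = (n.choose i : Cardinal) := by
  have honly := exists_mem_only hinj hE hfree
  have hres := taylor_isGradedResolution k (fun t => squarefreeExponent (E t)) (edgeIdeal k H)
    (edgeIdeal_eq_span k H E hE)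
  have hmin := taylor_isMinimal_of_exists_mem_only (k := k) honly
  refine ⟨⟨hres, hmin⟩, fun F ε hF i j => ?_, fun i => ?_⟩
  · have hcount : F.gradedBetti i j =
        ((((Finset.univ : Finset (Fin n)).powersetCard i).filter
          fun S => ((S.biUnion E).card : ℤ) = j).card : Cardinal) := by
      simpa only [lcmExponent_squarefreeExponent, degree_squarefreeExponent] using
        hF.gradedBetti_eq_card hres hmin i j
    refine ⟨hcount, hcount.trans ?_⟩
    rw [Finset.filter_image,
      Finset.card_image_of_injective _ (biUnion_injective_of_exists_mem_only honly)]
  · rw [FreeSequence.betti_eq_mk hres hmin i]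
    change Cardinal.lift (Cardinal.mk {S : Finset (Fin n) // S.card = i}) = _
    simp
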